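/- Let $T,\nu,\sigma>0$, $-\infty<u_l\le u_u<\infty$, $H=L^2(\mathbb R)$, $V=H^1(\mathbb R)$, and $W(V)=\{y\in L^2(0,T;V): \partial_t y\in L^2(0,T;V^*)\}$ (so that $y\in C([0,T];H)$). Let $\chi_c\in C_0^\infty(\mathbb R)$, let $y_0\in V$ and $y_d\in H$ have compact support, and put $$U_{ad}=\{u\in H^1(0,T): u_l\le u(t)\le u_u \text{ a.e.}\},\qquad J(y,u)=\tfrac12\|y(T)-y_d\|_H^2+\tfrac\sigma2\|u\|_{H^1(0,T)}^2 .$$ $(\mathcal P)$: minimise $J(y,u)$ over $(y,u)\in W(V)\times U_{ad}$ subject to the weak viscous Burgers equation: $y(0)=y_0$ in $H$ and, for a.e. $t\in(0,T)$ and all $\phi\in V$, $$\langle \partial_t y(t),\phi\rangle_{V^*,V}+\langle y(t)\partial_x y(t),\phi\rangle_H+\nu\langle\partial_x y(t),\partial_x\phi\rangle_H=u(t)\langle \chi_c,\phi\rangle_H. \tag{1}$$ $(\mathcal P_h)$: Let $h>0$. A particle discretisation consists of initial points $X_1<\dots<X_N$ with consecutive distances at most $h$, a smoothing length $\varepsilon>0$,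 and a kernel $\delta_\varepsilon(x)=\varepsilon^{-1}\zeta(x/\varepsilon)$, where $\zeta\in C^\infty(\mathbb R)\cap L^1(\mathbb R)\cap H^1(\mathbb R)$, $\int\zeta=1$ and, for some integer $r\ge1$, $\int x^k\zeta(x)\,dx=0$ for $1\le k\le r-1$ and $\int|x|^r|\zeta(x)|\,dx<\infty$; and, for each vector of positions $\xi\in\mathbb R^N$, a space of test functions $\mathcal T(\xi)$ with $\operatorname{span}\{\delta_\varepsilon(\cdot-\xi_i)\}_{i=1}^N\subseteq\mathcal T(\xi)\subseteq V$ (for example the span itself, or $V$). A discrete state for $u\in U_{ad}$ is a pair $(y_h,\Phi)$ with $y_h\in W(V)\cap L^\infty(0,T;V)$, $\Phi\in H^1(0,T)^N$, such that for all $t\in[0,T]$ $$y_h(x,t)=\sum_{i=1}^N\alpha_i(t)\,\delta_\varepsilon(x-\Phi_i(t))$$ for some coefficients $\alpha_i(t)\in\mathbb R$, with $\partial_t\Phi_i(t)=y_h(\Phi_i(t),t)$, $\Phi_i(0)=X_i$, such that (1) holds with $y=y_h$ for a.e. $t$ and all $\phi\in\mathcal T(\Phi(t))$, and $\langle y_h(0),\psi\rangle_H=\langle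 y_0,\psi\rangle_H$ for all $\psi\in\mathcal T(X)$. The problem $(\mathcal P_h)$ is to minimise $J(y_h,u)$ over all $u\in U_{ad}$ and all discrete states $(y_h,\Phi)$ for $u$. Only discretisations for which every $u\in U_{ad}$ has a discrete state are considered. **Lemma.** There is a constant $C>0$, independent of $h$ (and of the discretisation), such that $$\|u\|_{H^1(0,T)}\le C\qquad\text{and}\qquad\|u_h\|_{H^1(0,T)}\le C$$ for every optimal control $u\in U_{ad}$ of $(\mathcal P)$ and every optimal control $u_h\in U_{ad}$ of any such problem $(\mathcal P_h)$. -/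

import Mathlib

open MeasureTheory Set
open scoped ContDiff ENNReal

noncomputable section

namespace BurgersControl

/-- A test function: smooth with compact support contained in `Ω`. -/
def IsTestFun (Ω : Set ℝ) (θ : ℝ → ℝ) : Prop :=
  ContDiff ℝ ∞ θ ∧ HasCompactSupport θ ∧ tsupport θ ⊆ Ω

/-- A test function is square integrable. -/
lemma IsTestFun.memLp {Ω : Set ℝ} {θ : ℝ → ℝ} (h : IsTestFun Ω θ)
    (μ : Measure ℝ) [IsFiniteMeasureOnCompacts μ] : MemLp θ 2 μ :=
  h.1.continuous.memLp_of_hasCompactSupport h.2.1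

/-- The derivative of a test function is square integrable. -/
lemma IsTestFun.memLp_deriv {Ω : Set ℝ} {θ : ℝ → ℝ} (h : IsTestFun Ω θ)
    (μ : Measure ℝ) [IsFiniteMeasureOnCompacts μ] : MemLp (deriv θ) 2 μ :=
  (h.1.continuous_deriv (by simp)).memLp_of_hasCompactSupport h.2.1.deriv

/-- The pairs `(f, g)` in `L² × L²` such that `g` is the weak derivative of `f` on the open set
`Ω ⊆ ℝ`, where `μ` is Lebesgue measure on `Ω`. -/
def H1Submodule (Ω : Set ℝ) (μ : Measure ℝ) [IsFiniteMeasureOnCompacts μ] :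
    Submodule ℝ (WithLp 2 (Lp ℝ 2 μ × Lp ℝ 2 μ)) where
  carrier := {w | ∀ θ : ℝ → ℝ, IsTestFun Ω θ →
    ∫ x, w.fst x * deriv θ x ∂μ = - ∫ x, w.snd x * θ x ∂μ}
  zero_mem' := by
    intro θ _
    have h : ∀ ψ : ℝ → ℝ, ∫ x, ((0 : Lp ℝ 2 μ) : ℝ → ℝ) x * ψ x ∂μ = 0 := by
      intro ψ
      refine integral_eq_zero_of_ae ?_
      filter_upwards [Lp.coeFn_zero ℝ 2 μ] with x hx
      rw [hx]
      simp
    simp only [WithLp.zero_fst, WithLp.zero_snd]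
    rw [h, h, neg_zero]
  add_mem' := by
    intro a b ha hb θ hθ
    have key : ∀ (f g : Lp ℝ 2 μ) (ψ : ℝ → ℝ), MemLp ψ 2 μ →
        ∫ x, (f + g : Lp ℝ 2 μ) x * ψ x ∂μ = ∫ x, f x * ψ x ∂μ + ∫ x, g x * ψ x ∂μ := by
      intro f g ψ hψ
      have hf : Integrable (fun x => f x * ψ x) μ := (Lp.memLp f).integrable_mul hψ
      have hg : Integrable (fun x => g x * ψ x) μ := (Lp.memLp g).integrable_mul hψ
      rw [← integral_add hf hg]
      refine integral_congr_ae ?_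
      filter_upwards [Lp.coeFn_add f g] with x hx
      rw [hx, Pi.add_apply, add_mul]
    have h1 := ha θ hθ
    have h2 := hb θ hθ
    simp only [WithLp.add_fst, WithLp.add_snd]
    rw [key _ _ _ (hθ.memLp_deriv μ), key _ _ _ (hθ.memLp μ), h1, h2]
    ring
  smul_mem' := by
    intro c a ha θ hθ
    have key : ∀ (f : Lp ℝ 2 μ) (ψ : ℝ → ℝ),
        ∫ x, (c • f : Lp ℝ 2 μ) x * ψ x ∂μ = c * ∫ x, f x * ψ x ∂μ := by
      intro f ψ
      rw [← integral_const_mul]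
      refine integral_congr_ae ?_
      filter_upwards [Lp.coeFn_smul c f] with x hx
      simp [hx, mul_assoc]
    have h1 := ha θ hθ
    simp only [WithLp.smul_fst, WithLp.smul_snd]
    rw [key, key, h1]
    ring

/-- The Sobolev space `H¹(Ω)` of real functions on the open set `Ω ⊆ ℝ`, where `μ` is Lebesgue
measure on `Ω`; an element is a function together with its weak derivative. -/
def H1Space (Ω : Set ℝ) (μ : Measure ℝ) [IsFiniteMeasureOnCompacts μ] : Type :=
  H1Submodule Ω μ

section H1Space

variable {Ω : Set ℝ} {μ : Measure ℝ} [IsFiniteMeasureOnCompacts μ]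

instance : NormedAddCommGroup (H1Space Ω μ) :=
  inferInstanceAs (NormedAddCommGroup (H1Submodule Ω μ))

instance : InnerProductSpace ℝ (H1Space Ω μ) :=
  inferInstanceAs (InnerProductSpace ℝ (H1Submodule Ω μ))

/-- The function underlying an element of `H¹`. -/
def val (v : H1Space Ω μ) : Lp ℝ 2 μ := (Subtype.val (p := fun w => w ∈ H1Submodule Ω μ) v).fst

/-- The weak derivative of an element of `H¹`. -/
def weakDeriv (v : H1Space Ω μ) : Lp ℝ 2 μ :=
  (Subtype.val (p := fun w => w ∈ H1Submodule Ω μ) v).snd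

/-- The inner product of `H¹`. -/
lemma inner_eq (v w : H1Space Ω μ) :
    inner ℝ v w = inner ℝ (val v) (val w) + inner ℝ (weakDeriv v) (weakDeriv w) :=
  WithLp.prod_inner_apply (𝕜 := ℝ) (E := Lp ℝ 2 μ) (F := Lp ℝ 2 μ) _ _

/-- The norm of `H¹`. -/
lemma norm_sq_eq (v : H1Space Ω μ) : ‖v‖ ^ 2 = ‖val v‖ ^ 2 + ‖weakDeriv v‖ ^ 2 :=
  WithLp.prod_norm_sq_eq_of_L2 (α := Lp ℝ 2 μ) (β := Lp ℝ 2 μ) _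

end H1Space

/-- `H = L²(ℝ)`. -/
abbrev H : Type := Lp ℝ 2 (volume : Measure ℝ)

/-- `V = H¹(ℝ)`. -/
abbrev V : Type := H1Space univ (volume : Measure ℝ)

/-- Lebesgue measure on the time interval `(0, T)`. -/
abbrev timeMeasure (T : ℝ) : Measure ℝ := volume.restrict (Ioo 0 T)

/-- `H¹(0, T)`. -/
abbrev H1Time (T : ℝ) : Type := H1Space (Ioo 0 T) (timeMeasure T)

/-- An element `y` of `W(V) = {y ∈ L²(0,T;V) | ∂ₜ y ∈ L²(0,T;V*)}`, given together with its
weak time derivative (with respect to the triple `V ⊆ H = H* ⊆ V*`) and its continuous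
representative `[0,T] → H`, through which the values at the times `0` and `T` are defined. -/
structure W (T : ℝ) where
  /-- the function `t ↦ y(t) ∈ V`, defined for almost every `t ∈ (0,T)` -/
  toV : ℝ → V
  /-- the weak time derivative `t ↦ ∂ₜ y(t) ∈ V*` -/
  dt : ℝ → (V →L[ℝ] ℝ)
  /-- the representative in `C([0,T]; H)` -/
  traj : ℝ → H
  memLp_toV : MemLp toV 2 (timeMeasure T)
  memLp_dt : MemLp dt 2 (timeMeasure T)
  weak_dt : ∀ (v : V) (θ : ℝ → ℝ), IsTestFun (Ioo 0 T) θ →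
    ∫ t, inner ℝ (val (toV t)) (val v) * deriv θ t ∂(timeMeasure T) =
      - ∫ t, dt t v * θ t ∂(timeMeasure T)
  continuousOn_traj : ContinuousOn traj (Icc 0 T)
  traj_eq : ∀ᵐ t ∂(timeMeasure T), traj t = val (toV t)

/-- The data of the optimal control problem. -/
structure ControlProblem where
  /-- final time -/
  T : ℝ
  /-- viscosity -/
  ν : ℝ
  /-- regularisation parameter -/
  σ : ℝ
  /-- lower bound of the controls -/
  ul : ℝ
  /-- upper bound of the controls -/
  uu : ℝ
  /-- spatial localisation function -/
  χ : ℝ → ℝ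
  /-- initial value -/
  y0 : V
  /-- desired final state -/
  yd : H
  T_pos : 0 < T
  ν_pos : 0 < ν
  σ_pos : 0 < σ
  ul_le_uu : ul ≤ uu
  χ_smooth : ContDiff ℝ ∞ χ
  χ_supp : HasCompactSupport χ
  y0_supp : ∃ K : Set ℝ, IsCompact K ∧ ∀ᵐ x : ℝ, x ∉ K → val y0 x = 0
  yd_supp : ∃ K : Set ℝ, IsCompact K ∧ ∀ᵐ x : ℝ, x ∉ K → yd x = 0

namespace ControlProblem

variable (P : ControlProblem)

/-- The set of admissible controls. -/
def Uad : Set (H1Time P.T) :=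
  {u | ∀ᵐ t ∂(timeMeasure P.T), P.ul ≤ val u t ∧ val u t ≤ P.uu}

/-- The cost functional `½ ‖y(T) - y_d‖² + (σ/2) ‖u‖²`, with the norms of `H` and `H¹(0,T)`. -/
def J (y : W P.T) (u : H1Time P.T) : ℝ :=
  1 / 2 * ‖y.traj P.T - P.yd‖ ^ 2 + P.σ / 2 * ‖u‖ ^ 2

/-- The weak viscous Burgers equation at time `t`, tested with `φ ∈ V`:
`⟨∂ₜ y, φ⟩ + ⟨y ∂ₓ y, φ⟩ + ν ⟨∂ₓ y, ∂ₓ φ⟩ = ⟨χ u(t), φ⟩`. -/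
def BurgersAt (y : W P.T) (u : H1Time P.T) (t : ℝ) (φ : V) : Prop :=
  y.dt t φ + (∫ x, val (y.toV t) x * weakDeriv (y.toV t) x * val φ x)
      + P.ν * inner ℝ (weakDeriv (y.toV t)) (weakDeriv φ)
    = val u t * ∫ x, P.χ x * val φ x

/-- `y ∈ W(V)` is the weak solution of the viscous Burgers equation with control `u`. -/
def IsState (y : W P.T) (u : H1Time P.T) : Prop :=
  (∀ᵐ t ∂(timeMeasure P.T), ∀ φ : V, P.BurgersAt y u t φ) ∧
    ∀ ψ : H, inner ℝ (y.traj 0) ψ = inner ℝ (val P.y0) ψ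

/-- `(y, u)` solves the continuous problem: it minimises `J` over all
`(y, u) ∈ W(V) × U_ad` such that `y` is the state of `u`. -/
def IsSolution (y : W P.T) (u : H1Time P.T) : Prop :=
  u ∈ P.Uad ∧ P.IsState y u ∧
    ∀ (y' : W P.T) (u' : H1Time P.T), u' ∈ P.Uad → P.IsState y' u' → P.J y u ≤ P.J y' u'

end ControlProblem

/-- The dilated kernel `δ_ε(x) = ε⁻¹ ζ(ε⁻¹ x)`. -/
def dilate (ζ : ℝ → ℝ) (ε x : ℝ) : ℝ := ε⁻¹ * ζ (ε⁻¹ * x)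

/-- The particle function `∑ᵢ aᵢ δ(x - ξᵢ)` with kernel `δ`, coefficients `a`, positions `ξ`. -/
def particleFun {N : ℕ} (δ : ℝ → ℝ) (a ξ : Fin N → ℝ) (x : ℝ) : ℝ :=
  ∑ i, a i * δ (x - ξ i)

/-- A particle discretisation with initial point distance (at most) `h`. -/
structure ParticleScheme (h : ℝ) where
  /-- number of particles -/
  N : ℕ
  /-- initial particle positions -/
  X : Fin N → ℝ
  strictMono_X : StrictMono X
  spacing : ∀ i j : Fin N, (j : ℕ) = (i : ℕ) + 1 → X j - X i ≤ h
  /-- smoothing kernel -/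
  ζ : ℝ → ℝ
  ζ_smooth : ContDiff ℝ ∞ ζ
  ζ_memLp_one : MemLp ζ 1
  ζ_memLp : MemLp ζ 2
  ζ_memLp_deriv : MemLp (deriv ζ) 2
  ζ_integral : ∫ x, ζ x = 1
  /-- order of the moment conditions -/
  r : ℕ
  one_le_r : 1 ≤ r
  ζ_moment : ∀ k : ℕ, 1 ≤ k → k < r → ∫ x, x ^ k * ζ x = 0
  ζ_integrable : Integrable (fun x => |x| ^ r * |ζ x|)
  /-- smoothing length -/
  ε : ℝ
  ε_pos : 0 < ε
  /-- the space of test functions used when the particles are at the positions `ξ`: any subspace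
  of `V` that contains all particle functions, for example `V` itself or only their span -/
  test : (Fin N → ℝ) → Submodule ℝ V
  particle_mem_test : ∀ (a ξ : Fin N → ℝ) (v : V),
    (val v : ℝ → ℝ) =ᵐ[volume] particleFun (dilate ζ ε) a ξ → v ∈ test ξ

namespace ControlProblem

variable (P : ControlProblem) {h : ℝ} (S : ParticleScheme h)

/-- `(y, Φ)` is the discrete state for the control `u`: `y ∈ W(V) ∩ L^∞(0,T;V)` is a particle
function `y(x,t) = ∑ᵢ αᵢ(t) δ_ε(x - Φᵢ(t))`; the particle paths `Φᵢ ∈ H¹(0,T)` start at `Xᵢ` and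
satisfy `∂ₜ Φᵢ(t) = y(Φᵢ(t), t)` (written as an integral equation with a right-hand side in
`L²(0,T)`); and the weak Burgers equation and the initial condition hold for the test functions
of the scheme. -/
def IsDiscreteState (y : W P.T) (Φ : Fin S.N → ℝ → ℝ) (u : H1Time P.T) : Prop :=
  MemLp y.toV ∞ (timeMeasure P.T) ∧
  (∃ α : Fin S.N → ℝ → ℝ,
    (∀ t ∈ Icc 0 P.T, (y.traj t : ℝ → ℝ) =ᵐ[volume]
      particleFun (dilate S.ζ S.ε) (fun i => α i t) (fun i => Φ i t)) ∧
    ∀ i,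
      MemLp (fun t => particleFun (dilate S.ζ S.ε) (fun j => α j t) (fun j => Φ j t) (Φ i t)) 2
        (timeMeasure P.T) ∧
      ∀ t ∈ Icc 0 P.T, Φ i t = S.X i +
        ∫ s in (0 : ℝ)..t,
          particleFun (dilate S.ζ S.ε) (fun j => α j s) (fun j => Φ j s) (Φ i s)) ∧
  (∀ᵐ t ∂(timeMeasure P.T), ∀ φ ∈ S.test (fun i => Φ i t), P.BurgersAt y u t φ) ∧
  ∀ ψ ∈ S.test S.X, inner ℝ (y.traj 0) (val ψ) = inner ℝ (val P.y0) (val ψ)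

/-- Every admissible control has a discrete state. -/
def DiscreteSolvable : Prop :=
  ∀ u ∈ P.Uad, ∃ (y : W P.T) (Φ : Fin S.N → ℝ → ℝ), P.IsDiscreteState S y Φ u

/-- `(y, Φ, u)` solves the discrete problem: it minimises `J(y, u)` over all `u ∈ U_ad` and all
discrete states `(y, Φ)` for `u`. -/
def IsDiscreteSolution (y : W P.T) (Φ : Fin S.N → ℝ → ℝ) (u : H1Time P.T) : Prop :=
  u ∈ P.Uad ∧ P.IsDiscreteState S y Φ u ∧
    ∀ (y' : W P.T) (Φ' : Fin S.N → ℝ → ℝ) (u' : H1Time P.T),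
      u' ∈ P.Uad → P.IsDiscreteState S y' Φ' u' → P.J y u ≤ P.J y' u'

end ControlProblem

end BurgersControl

end

/-! Both bounds come from comparing costs: `J` dominates `σ / 2 * ‖u‖ ^ 2`, so an optimal control is
bounded as soon as one admissible pair has bounded cost. For the continuous problem any one solution
serves as competitor for all others. For the discrete problems the competitor is a discrete state of
the constant control `ul`, and its final value must be bounded independently of the discretisation.

That bound is an energy estimate. A discrete state is a particle function at its own particle
positions, hence an admissible test function for its own equation. Testing with it removes the
convection term, since `y ∂ₓy y = ∂ₓ(y³)/3`, and the viscous term has a favourable sign; only the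
control feeds energy, at rate at most `c ‖χ‖ ‖y(t)‖` when `|u| ≤ c`. Testing the initial condition
in the same way gives `‖y(0)‖ ≤ ‖y₀‖`. No particle parameter enters
(`IsDiscreteState.norm_traj_final_le`).

The analytic core is the energy equality in `W(V)` (`norm_sq_sub_norm_sq_eq_integral`), obtained
from the weak time derivative by averaging difference quotients of `‖y‖²`. -/

noncomputable section

namespace BurgersControl

open Filter Topology

/-! ### Weak derivatives in space and the vanishing convection term. -/

section Sobolev

variable {Ω : Set ℝ} {μ : Measure ℝ} [IsFiniteMeasureOnCompacts μ]

/-- A square integrable function with a square integrable weak derivative defines an element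
of `H¹`. -/
lemma exists_H1Space {f g : ℝ → ℝ} (hf : MemLp f 2 μ) (hg : MemLp g 2 μ)
    (h : ∀ θ : ℝ → ℝ, IsTestFun Ω θ → ∫ x, f x * deriv θ x ∂μ = - ∫ x, g x * θ x ∂μ) :
    ∃ v : H1Space Ω μ, (val v : ℝ → ℝ) =ᵐ[μ] f ∧ (weakDeriv v : ℝ → ℝ) =ᵐ[μ] g := by
  refine ⟨⟨WithLp.toLp 2 (hf.toLp f, hg.toLp g), ?_⟩, hf.coeFn_toLp, hg.coeFn_toLp⟩
  intro θ hθ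
  have h1 : ∫ x, (hf.toLp f) x * deriv θ x ∂μ = ∫ x, f x * deriv θ x ∂μ :=
    integral_congr_ae (hf.coeFn_toLp.mono fun x hx => by simp only [hx])
  have h2 : ∫ x, (hg.toLp g) x * θ x ∂μ = ∫ x, g x * θ x ∂μ :=
    integral_congr_ae (hg.coeFn_toLp.mono fun x hx => by simp only [hx])
  exact h1.trans ((h θ hθ).trans (congrArg Neg.neg h2.symm))

/-- The defining property of the weak derivative. -/
lemma integral_val_mul_deriv (v : H1Space Ω μ) {θ : ℝ → ℝ} (hθ : IsTestFun Ω θ) :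
    ∫ x, val v x * deriv θ x ∂μ = - ∫ x, weakDeriv v x * θ x ∂μ :=
  v.2 θ hθ

/-- The inclusion `H¹ → L²` as a linear map. -/
def valₗ : H1Space Ω μ →ₗ[ℝ] Lp ℝ 2 μ where
  toFun := val
  map_add' _ _ := rfl
  map_smul' _ _ := rfl

/-- Classical integration by parts against a test function. -/
lemma integral_mul_deriv_testFun {f θ : ℝ → ℝ} (hf : ContDiff ℝ ∞ f) (hθ : IsTestFun univ θ) :
    ∫ x, f x * deriv θ x = - ∫ x, deriv f x * θ x := by
  have hf1 : Continuous (deriv f) := hf.continuous_deriv (by simp)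
  have hθ1 : Continuous (deriv θ) := hθ.1.continuous_deriv (by simp)
  refine integral_mul_deriv_eq_deriv_mul_of_integrable
    (fun x _ => (hf.differentiable (by simp) x).hasDerivAt)
    (fun x _ => (hθ.1.differentiable (by simp) x).hasDerivAt) ?_ ?_ ?_
  · exact (hf.continuous.mul hθ1).integrable_of_hasCompactSupport hθ.2.1.deriv.mul_left
  · exact (hf1.mul hθ.1.continuous).integrable_of_hasCompactSupport hθ.2.1.mul_left
  · exact (hf.continuous.mul hθ.1.continuous).integrable_of_hasCompactSupport hθ.2.1.mul_left

/-- A smooth square integrable function with square integrable derivative belongs to `V`. -/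
lemma exists_V_of_contDiff {f : ℝ → ℝ} (hf : ContDiff ℝ ∞ f) (h : MemLp f 2)
    (h' : MemLp (deriv f) 2) : ∃ v : V, (val v : ℝ → ℝ) =ᵐ[volume] f := by
  obtain ⟨v, hv, -⟩ := exists_H1Space h h' fun θ hθ => integral_mul_deriv_testFun hf hθ
  exact ⟨v, hv⟩

/-- The weak derivative of a smooth function is its classical derivative. -/
lemma weakDeriv_ae_eq_deriv {f : ℝ → ℝ} (hf : ContDiff ℝ ∞ f) {v : V}
    (hv : (val v : ℝ → ℝ) =ᵐ[volume] f) : (weakDeriv v : ℝ → ℝ) =ᵐ[volume] deriv f := by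
  have hloc : LocallyIntegrable (weakDeriv v : ℝ → ℝ) volume :=
    (Lp.memLp (weakDeriv v)).locallyIntegrable (by norm_num)
  have hf1 : Continuous (deriv f) := hf.continuous_deriv (by simp)
  refine ae_eq_of_integral_contDiff_smul_eq hloc hf1.locallyIntegrable ?_
  intro θ hθ hθc
  have ht : IsTestFun univ θ := ⟨hθ, hθc, subset_univ _⟩
  have h1 := integral_val_mul_deriv v ht
  have h2 := integral_mul_deriv_testFun hf ht
  have h3 : ∫ x, val v x * deriv θ x = ∫ x, f x * deriv θ x :=
    integral_congr_ae (hv.mono fun x hx => by simp only [hx])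
  simp only [smul_eq_mul, mul_comm (θ _)]
  linarith

/-- A `C¹` function in `L²` whose derivative is in `L²` is bounded. -/
lemma exists_bound_of_memLp {f : ℝ → ℝ} (hf : ContDiff ℝ 1 f) (h : MemLp f 2)
    (h' : MemLp (deriv f) 2) : ∃ B : ℝ, ∀ x, |f x| ≤ B := by
  have hd : ∀ x, HasDerivAt (fun x => f x ^ 2) (2 * (f x * deriv f x)) x := fun x => by
    have := (hf.differentiable (by simp) x).hasDerivAt.pow 2
    refine this.congr_deriv ?_
    norm_num
    ring
  have hi : Integrable (fun x => 2 * (f x * deriv f x)) := (h.integrable_mul h').const_mul 2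
  -- The bracket bounds `f x ^ 2`, by integrating its derivative from `0`; then `|f x| ≤ 1 + f x ^
  -- 2` is used.
  refine ⟨1 + (f 0 ^ 2 + ∫ x, |2 * (f x * deriv f x)|), fun x => ?_⟩
  have h1 : f x ^ 2 - f 0 ^ 2 = ∫ t in (0 : ℝ)..x, 2 * (f t * deriv f t) :=
    (intervalIntegral.integral_eq_sub_of_hasDerivAt (fun t _ => hd t) hi.intervalIntegrable).symm
  have h2 : |∫ t in (0 : ℝ)..x, 2 * (f t * deriv f t)| ≤ ∫ x, |2 * (f x * deriv f x)| := by
    rw [← Real.norm_eq_abs]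
    refine (intervalIntegral.norm_integral_le_integral_norm_uIoc).trans ?_
    exact setIntegral_le_integral hi.norm (Eventually.of_forall fun _ => norm_nonneg _)
  have h3 := (abs_le.1 h2).2
  nlinarith [sq_abs (f x), sq_nonneg (|f x| - 1)]

/-- The convection term of the Burgers equation does not contribute to the energy balance. -/
lemma integral_convection_eq_zero {f : ℝ → ℝ} (hf : ContDiff ℝ 1 f) (h : MemLp f 2)
    (h' : MemLp (deriv f) 2) : ∫ x, f x * deriv f x * f x = 0 := by
  obtain ⟨B, hB⟩ := exists_bound_of_memLp hf h h'
  have hm : AEStronglyMeasurable f volume := hf.continuous.aestronglyMeasurable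
  have hb : ∀ᵐ x : ℝ, ‖f x‖ ≤ B := Eventually.of_forall hB
  have h1 : Integrable (fun x => f x * deriv f x * f x) := (h.integrable_mul h').mul_bdd hm hb
  have h2 : Integrable (fun x => f x * f x * f x) := (h.integrable_mul h).mul_bdd hm hb
  -- The integrand is a third of the derivative of the cube, and boundedness of `f` makes both the
  -- cube and its derivative integrable.
  have hd : ∀ x, HasDerivAt (fun x => f x * f x * f x) (3 * (f x * deriv f x * f x)) x := by
    intro x
    have hx := (hf.differentiable (by simp) x).hasDerivAt
    refine ((hx.mul hx).mul hx).congr_deriv ?_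
    simp only [Pi.mul_apply]
    ring
  have h3 := integral_eq_zero_of_hasDerivAt_of_integrable hd (h1.const_mul 3) h2
  rw [integral_const_mul] at h3
  linarith

end Sobolev

/-- Constant functions belong to `H¹(0,T)`. -/
lemma exists_H1Time_const (T c : ℝ) :
    ∃ u : H1Time T, (val u : ℝ → ℝ) =ᵐ[timeMeasure T] fun _ => c := by
  have h : ∀ θ : ℝ → ℝ, IsTestFun (Ioo 0 T) θ →
      ∫ x, c * deriv θ x ∂(timeMeasure T) = - ∫ x, 0 * θ x ∂(timeMeasure T) := fun θ hθ => by
    have hd : ∀ x, x ∉ Ioo 0 T → deriv θ x = 0 := fun x hx =>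
      image_eq_zero_of_notMem_tsupport fun h => hx (hθ.2.2 (tsupport_deriv_subset h))
    have h0 := integral_eq_zero_of_hasDerivAt_of_integrable
      (fun x => (hθ.1.differentiable (by simp) x).hasDerivAt)
      ((hθ.1.continuous_deriv (by simp)).integrable_of_hasCompactSupport hθ.2.1.deriv)
      (hθ.1.continuous.integrable_of_hasCompactSupport hθ.2.1)
    rw [integral_const_mul, setIntegral_eq_integral_of_forall_compl_eq_zero hd, h0]
    simp
  obtain ⟨u, hu, -⟩ := exists_H1Space (memLp_const c) (memLp_const 0) h
  exact ⟨u, hu⟩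

/-! ### Fundamental theorem of calculus for weak derivatives in time. -/

section WeakDerivative

/-- A smooth step from `0` to `1` on the interval `[s, s + δ]`. -/
def smoothStep (s δ τ : ℝ) : ℝ := Real.smoothTransition (δ⁻¹ * (τ - s))

lemma contDiff_smoothStep (s δ : ℝ) : ContDiff ℝ ∞ (smoothStep s δ) :=
  Real.smoothTransition.contDiff.comp (contDiff_const.mul (contDiff_id.sub contDiff_const))

lemma smoothStep_of_le {s δ τ : ℝ} (hδ : 0 < δ) (h : τ ≤ s) : smoothStep s δ τ = 0 :=
  Real.smoothTransition.zero_of_nonpos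
    (mul_nonpos_of_nonneg_of_nonpos (inv_nonneg.2 hδ.le) (sub_nonpos.2 h))

lemma smoothStep_of_ge {s δ τ : ℝ} (hδ : 0 < δ) (h : s + δ ≤ τ) : smoothStep s δ τ = 1 := by
  refine Real.smoothTransition.one_of_one_le ?_
  rw [← inv_mul_cancel₀ hδ.ne']
  exact mul_le_mul_of_nonneg_left (by linarith) (inv_nonneg.2 hδ.le)

lemma smoothStep_mem_Icc (s δ τ : ℝ) : smoothStep s δ τ ∈ Icc (0 : ℝ) 1 :=
  ⟨Real.smoothTransition.nonneg _, Real.smoothTransition.le_one _⟩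

/-- Such points are global minima. -/
lemma deriv_smoothTransition_of_nonpos {r : ℝ} (h : r ≤ 0) :
    deriv Real.smoothTransition r = 0 :=
  IsLocalMin.deriv_eq_zero <| Eventually.of_forall fun y => by
    rw [Real.smoothTransition.zero_of_nonpos h]
    exact Real.smoothTransition.nonneg y

lemma deriv_smoothTransition_of_one_le {r : ℝ} (h : 1 ≤ r) :
    deriv Real.smoothTransition r = 0 :=
  IsLocalMax.deriv_eq_zero <| Eventually.of_forall fun y => by
    rw [Real.smoothTransition.one_of_one_le h]
    exact Real.smoothTransition.le_one y

lemma deriv_smoothStep (s δ τ : ℝ) :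
    deriv (smoothStep s δ) τ = δ⁻¹ * deriv Real.smoothTransition (δ⁻¹ * (τ - s)) := by
  have h1 : HasDerivAt (fun τ => δ⁻¹ * (τ - s)) δ⁻¹ τ := by
    simpa using ((hasDerivAt_id τ).sub_const s).const_mul δ⁻¹
  have h2 := ((Real.smoothTransition.contDiff (n := 1)).differentiable (by simp)
    (δ⁻¹ * (τ - s))).hasDerivAt
  rw [mul_comm]
  exact (h2.comp τ h1).deriv

/-- The derivative of a smooth step, as an approximation of the Dirac mass. -/
lemma setIntegral_mul_deriv_smoothStep {T s δ : ℝ} (p : ℝ → ℝ) (hδ : 0 < δ) (hs : 0 < s)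
    (hT : s + δ < T) :
    ∫ τ in Ioo 0 T, p τ * deriv (smoothStep s δ) τ =
      ∫ r in (0 : ℝ)..1, p (s + δ * r) * deriv Real.smoothTransition r := by
  have h0 : ∀ τ, τ ∉ Ioc s (s + δ) → p τ * deriv (smoothStep s δ) τ = 0 := by
    intro τ hτ
    rw [deriv_smoothStep]
    rcases le_or_gt τ s with h | h
    · rw [deriv_smoothTransition_of_nonpos, mul_zero, mul_zero]
      exact mul_nonpos_of_nonneg_of_nonpos (inv_nonneg.2 hδ.le) (sub_nonpos.2 h)
    · rw [deriv_smoothTransition_of_one_le, mul_zero, mul_zero]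
      rw [← inv_mul_cancel₀ hδ.ne']
      refine mul_le_mul_of_nonneg_left ?_ (inv_nonneg.2 hδ.le)
      by_contra hc
      exact hτ ⟨h, by linarith⟩
  have h2 : ∀ τ, τ ∉ Ioo 0 T → p τ * deriv (smoothStep s δ) τ = 0 := fun τ hτ =>
    h0 τ fun h => hτ ⟨hs.trans h.1, h.2.trans_lt hT⟩
  have h3 : Function.support (fun τ => p τ * deriv (smoothStep s δ) τ) ⊆ Ioc s (s + δ) :=
    fun τ hτ => by
      by_contra hc
      exact hτ (h0 τ hc)
  rw [setIntegral_eq_integral_of_forall_compl_eq_zero h2,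
    ← intervalIntegral.integral_eq_integral_of_support_subset h3]
  have h1 := intervalIntegral.integral_comp_add_mul (a := 0) (b := 1)
    (fun τ => p τ * deriv (smoothStep s δ) τ) hδ.ne' s
  simp only [mul_zero, add_zero, mul_one, smul_eq_mul] at h1
  rw [← mul_right_inj' (inv_ne_zero hδ.ne'), ← h1, ← intervalIntegral.integral_const_mul]
  refine intervalIntegral.integral_congr fun r _ => ?_
  simp only [deriv_smoothStep, add_sub_cancel_left, inv_mul_cancel_left₀ hδ.ne']
  ring

/-- The weight has mass one on `[0, 1]`. In this rescaled form the integral is continuous in `δ`,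
also at `δ = 0`, where it equals `p s`. -/
lemma tendsto_integral_mul_deriv_smoothTransition {p : ℝ → ℝ} (hp : Continuous p) (s : ℝ) :
    Tendsto (fun δ => ∫ r in (0 : ℝ)..1, p (s + δ * r) * deriv Real.smoothTransition r)
      (𝓝 0) (𝓝 (p s)) := by
  have hS : Continuous (deriv Real.smoothTransition) :=
    (Real.smoothTransition.contDiff (n := 1)).continuous_deriv le_rfl
  have hc : Continuous fun δ : ℝ =>
      ∫ r in (0 : ℝ)..1, p (s + δ * r) * deriv Real.smoothTransition r := by
    refine intervalIntegral.continuous_parametric_intervalIntegral_of_continuous' ?_ 0 1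
    simp only [Function.uncurry_def]
    fun_prop
  have h := hc.tendsto 0
  have h1 : ∫ r in (0 : ℝ)..1, deriv Real.smoothTransition r = 1 := by
    rw [intervalIntegral.integral_deriv_eq_sub
      (fun x _ => (Real.smoothTransition.contDiff (n := 1)).differentiable (by simp) x)
      (hS.intervalIntegrable 0 1)]
    simp
  simpa [intervalIntegral.integral_const_mul, h1] using h

/-- This difference is a smooth approximation of the indicator of `(s, t]`, supported in `[s, t +
δ]`. -/
lemma isTestFun_smoothStep_sub {T s t δ : ℝ} (hδ : 0 < δ) (hs : 0 < s) (hst : s ≤ t)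
    (hT : t + δ < T) : IsTestFun (Ioo 0 T) fun τ => smoothStep s δ τ - smoothStep t δ τ := by
  have h0 : ∀ τ, τ ∉ Icc s (t + δ) → smoothStep s δ τ - smoothStep t δ τ = 0 := by
    intro τ hτ
    rcases lt_or_ge τ s with h | h
    · rw [smoothStep_of_le hδ h.le, smoothStep_of_le hδ (h.le.trans hst), sub_zero]
    · have h' : t + δ < τ := by
        by_contra hc
        exact hτ ⟨h, not_lt.1 hc⟩
      rw [smoothStep_of_ge hδ (by linarith), smoothStep_of_ge hδ h'.le, sub_self]
  refine ⟨(contDiff_smoothStep s δ).sub (contDiff_smoothStep t δ),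
    HasCompactSupport.intro isCompact_Icc h0, ?_⟩
  refine (closure_minimal (fun τ hτ => ?_) isClosed_Icc).trans
    (Icc_subset_Ioo hs hT)
  by_contra hc
  exact hτ (h0 τ hc)

/-- A continuous function with an integrable weak derivative satisfies the fundamental theorem
of calculus. -/
lemma sub_eq_integral_of_weak_deriv {T : ℝ} {p q : ℝ → ℝ} (hp : ContinuousOn p (Icc 0 T))
    (hq : IntegrableOn q (Ioo 0 T))
    (h : ∀ θ, IsTestFun (Ioo 0 T) θ →
      ∫ τ in Ioo 0 T, p τ * deriv θ τ = - ∫ τ in Ioo 0 T, q τ * θ τ)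
    {s t : ℝ} (hs : 0 < s) (hst : s ≤ t) (ht : t < T) :
    p t - p s = ∫ τ in s..t, q τ := by
  have hT : 0 ≤ T := (hs.le.trans hst).trans ht.le
  -- Extending by the boundary values makes the function continuous on the whole line, as the limit
  -- lemma requires.
  set pc : ℝ → ℝ := IccExtend hT ((Icc 0 T).domRestrict p) with hpc
  have hpcc : Continuous pc := (continuousOn_iff_continuous_domRestrict.1 hp).Icc_extend'
  have hpe : ∀ τ ∈ Icc 0 T, pc τ = p τ := fun τ hτ => by
    rw [hpc, IccExtend_of_mem _ _ hτ]; rfl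
  set l : Filter ℝ := 𝓝[>] 0
  have hlt : ∀ c > 0, ∀ᶠ δ in l, δ < c := fun c hc =>
    (eventually_lt_nhds hc).filter_mono nhdsWithin_le_nhds
  have hl : ∀ᶠ δ in l, 0 < δ ∧ t + δ < T := by
    filter_upwards [eventually_mem_nhdsWithin, hlt _ (sub_pos.2 ht)] with δ h1 h2
    exact ⟨h1, by linarith⟩
  have hL : Tendsto (fun δ => - ∫ τ in Ioo 0 T, q τ * (smoothStep s δ τ - smoothStep t δ τ)) l
      (𝓝 (pc s - pc t)) := by
    refine Tendsto.congr' ?_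
      (((tendsto_integral_mul_deriv_smoothTransition hpcc s).sub
        (tendsto_integral_mul_deriv_smoothTransition hpcc t)).mono_left nhdsWithin_le_nhds)
    filter_upwards [hl] with δ ⟨hδ, hδT⟩
    have hi : ∀ s, IntegrableOn (fun τ => pc τ * deriv (smoothStep s δ) τ) (Ioo 0 T) := fun s =>
      (((hpcc.mul ((contDiff_smoothStep s δ).continuous_deriv (by simp))).integrableOn_Icc
        (a := 0) (b := T)).mono_set Ioo_subset_Icc_self)
    rw [← h _ (isTestFun_smoothStep_sub hδ hs hst hδT),
      ← setIntegral_mul_deriv_smoothStep pc hδ hs ((add_le_add_left hst δ).trans_lt hδT),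
      ← setIntegral_mul_deriv_smoothStep pc hδ (hs.trans_le hst) hδT,
      ← integral_sub (hi s) (hi t)]
    refine setIntegral_congr_fun measurableSet_Ioo fun τ hτ => ?_
    have hd : ∀ s, DifferentiableAt ℝ (smoothStep s δ) τ := fun s =>
      (contDiff_smoothStep s δ).differentiable (by simp) τ
    simp only [hpe τ (Ioo_subset_Icc_self hτ), deriv_fun_sub (hd s) (hd t)]
    ring
  have hR : Tendsto (fun δ => ∫ τ in Ioo 0 T, q τ * (smoothStep s δ τ - smoothStep t δ τ)) l
      (𝓝 (∫ τ in Ioo 0 T, (Ioc s t).indicator q τ)) := by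
    refine tendsto_integral_filter_of_dominated_convergence (fun τ => |q τ|) ?_ ?_ hq.norm ?_
    · refine Eventually.of_forall fun δ => hq.aestronglyMeasurable.mul ?_
      exact ((contDiff_smoothStep s δ).continuous.sub
        (contDiff_smoothStep t δ).continuous).aestronglyMeasurable
    · refine Eventually.of_forall fun δ => Eventually.of_forall fun τ => ?_
      rw [norm_mul, Real.norm_eq_abs]
      refine mul_le_of_le_one_right (abs_nonneg _) (abs_le.2 ?_)
      have h1 := smoothStep_mem_Icc s δ τ
      have h2 := smoothStep_mem_Icc t δ τ
      exact ⟨by linarith [h1.1, h2.2], by linarith [h1.2, h2.1]⟩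
    -- At each fixed `τ` the steps are eventually constant in `δ`. A step vanishes at its left end,
    -- so the limit is the indicator of an interval open at `s` and closed at `t`.
    · refine Eventually.of_forall fun τ => tendsto_const_nhds.congr' ?_
      have key : ∀ a, ∀ᶠ δ in l, smoothStep a δ τ = if a < τ then 1 else 0 := by
        intro a
        split_ifs with ha
        · filter_upwards [hl, hlt _ (sub_pos.2 ha)]
            with δ h1 h2
          exact smoothStep_of_ge h1.1 (by linarith)
        · filter_upwards [hl] with δ h1
          exact smoothStep_of_le h1.1 (not_lt.1 ha)
      filter_upwards [key s, key t] with δ h1 h2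
      rw [h1, h2]
      by_cases hm : τ ∈ Ioc s t
      · rw [indicator_of_mem hm, if_pos hm.1, if_neg (not_lt.2 hm.2)]
        ring
      · rw [indicator_of_notMem hm]
        by_cases h3 : s < τ
        · rw [if_pos h3, if_pos (lt_of_not_ge fun h4 => hm ⟨h3, h4⟩)]
          ring
        · rw [if_neg h3, if_neg fun h4 => h3 (hst.trans_lt h4)]
          ring
  have h1 := tendsto_nhds_unique hL hR.neg
  have hsub : Ioc s t ⊆ Ioo 0 T := fun τ hτ => ⟨hs.trans hτ.1, hτ.2.trans_lt ht⟩
  rw [setIntegral_indicator measurableSet_Ioc,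
    inter_eq_self_of_subset_right hsub,
    ← intervalIntegral.integral_of_le hst, hpe s ⟨hs.le, hst.trans ht.le⟩,
    hpe t ⟨hs.le.trans hst, ht.le⟩] at h1
  linarith

end WeakDerivative

/-! ### The energy equality for curves with derivative in the dual space. -/

section Energy

variable {E : Type*} [NormedAddCommGroup E] [NormedSpace ℝ E]

/-- The pairing of translates of two square integrable functions is continuous in the
translations. -/
lemma continuous_integral_translate {F : ℝ → E →L[ℝ] ℝ} {Y : ℝ → E} (hF : MemLp F 2)
    (hY : MemLp Y 2) (s : Set ℝ) :
    Continuous fun p : ℝ × ℝ => ∫ t in s, F (t + p.1) (Y (t + p.2)) := by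
  -- Translation is continuous in `L²`; restriction to `s` and the duality pairing of two `L²`
  -- spaces preserve this continuity.
  let g : C(ℝ, C(ℝ, ℝ)) := (ContinuousMap.mk fun a : ℝ × ℝ => a.2 + a.1).curry
  have hg : ∀ z, MeasurePreserving (g z) volume volume := fun z =>
    measurePreserving_add_right volume z
  have h1 : Continuous fun z => Lp.compMeasurePreserving (g z) (hg z) (hF.toLp F) :=
    continuous_const.compMeasurePreservingLp g.continuous hg (by norm_num)
  have h2 : Continuous fun z => Lp.compMeasurePreserving (g z) (hg z) (hY.toLp Y) :=
    continuous_const.compMeasurePreservingLp g.continuous hg (by norm_num)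
  have h3 := (LpToLpRestrictCLM ℝ (E →L[ℝ] ℝ) ℝ volume 2 s).continuous.comp
    (h1.comp continuous_fst (X := ℝ × ℝ))
  have h4 := (LpToLpRestrictCLM ℝ E ℝ volume 2 s).continuous.comp
    (h2.comp continuous_snd (X := ℝ × ℝ))
  have h5 := (((ContinuousLinearMap.id ℝ (E →L[ℝ] ℝ)).lpPairing
    (volume.restrict s) 2 2).continuous.comp h3).clm_apply h4
  refine h5.congr fun p => ?_
  simp only [Function.comp_apply, ContinuousLinearMap.lpPairing_eq_integral]
  refine integral_congr_ae ?_
  have e1 := Lp.coeFn_compMeasurePreserving (hF.toLp F) (hg p.1)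
  have e2 := Lp.coeFn_compMeasurePreserving (hY.toLp Y) (hg p.2)
  have e3 := (hg p.1).quasiMeasurePreserving.ae_eq_comp hF.coeFn_toLp
  have e4 := (hg p.2).quasiMeasurePreserving.ae_eq_comp hY.coeFn_toLp
  filter_upwards [LpToLpRestrictCLM_coeFn ℝ s (Lp.compMeasurePreserving (g p.1) (hg p.1)
      (hF.toLp F)), LpToLpRestrictCLM_coeFn ℝ s (Lp.compMeasurePreserving (g p.2) (hg p.2)
      (hY.toLp Y)), ae_restrict_of_ae e1, ae_restrict_of_ae e2, ae_restrict_of_ae e3,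
      ae_restrict_of_ae e4] with t k1 k2 k3 k4 k5 k6
  rw [k1, k2, k3, k4, k5, k6]
  rfl

lemma integrable_clm_apply {F : ℝ → E →L[ℝ] ℝ} {Y : ℝ → E} {μ : Measure ℝ} (hF : MemLp F 2 μ)
    (hY : MemLp Y 2 μ) : Integrable (fun t => F t (Y t)) μ := by
  refine (hF.norm.integrable_mul hY.norm).mono
    (isBoundedBilinearMap_apply.continuous.comp_aestronglyMeasurable
      (hF.aestronglyMeasurable.prodMk hY.aestronglyMeasurable))
    (Eventually.of_forall fun t => ?_)
  refine ((F t).le_opNorm (Y t)).trans (le_abs_self _)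

lemma memLp_comp_add_right {G : Type*} [NormedAddCommGroup G] {F : ℝ → G} (hF : MemLp F 2)
    (r : ℝ) : MemLp (fun t => F (t + r)) 2 :=
  hF.comp_measurePreserving (measurePreserving_add_right volume r)

lemma memLp_two_norm_sq {G : Type*} [NormedAddCommGroup G] {F : ℝ → G} (hF : MemLp F 2) :
    Integrable fun t => ‖F t‖ ^ 2 :=
  hF.norm.integrable_sq

/-- Fubini's theorem for the averaged pairing. -/
lemma integral_integral_translate_swap {F : ℝ → E →L[ℝ] ℝ} {Z : ℝ → E} (hF : MemLp F 2)
    (hZ : MemLp Z 2) (hFm : StronglyMeasurable F) (hZm : StronglyMeasurable Z) (s : Set ℝ)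
    (h : ℝ) :
    ∫ t in s, ∫ r in (0 : ℝ)..1, F (t + h * r) (Z t) =
      ∫ r in (0 : ℝ)..1, ∫ t in s, F (t + h * r) (Z t) := by
  have hm : StronglyMeasurable fun p : ℝ × ℝ => F (p.1 + h * p.2) (Z p.1) :=
    isBoundedBilinearMap_apply.continuous.comp_stronglyMeasurable
      ((hFm.comp_measurable (by fun_prop : Measurable fun p : ℝ × ℝ => p.1 + h * p.2)).prodMk
        (hZm.comp_measurable measurable_fst))
  have hi : Integrable (fun p : ℝ × ℝ => F (p.1 + h * p.2) (Z p.1))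
      (volume.prod (volume.restrict (Ioc 0 1))) := by
    rw [integrable_prod_iff' hm.aestronglyMeasurable]
    refine ⟨Eventually.of_forall fun r =>
      integrable_clm_apply (memLp_comp_add_right hF (h * r)) hZ, ?_⟩
    -- The bound uses `‖F‖ ‖Z‖ ≤ ‖F‖² + ‖Z‖²` and translation invariance, so it does not depend on
    -- `r`.
    refine Integrable.of_bound (C := (∫ t, ‖F t‖ ^ 2) + ∫ t, ‖Z t‖ ^ 2)
      hm.norm.integral_prod_left'.aestronglyMeasurable
      (Eventually.of_forall fun r => ?_)
    have h1 := memLp_two_norm_sq (memLp_comp_add_right hF (h * r))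
    have h2 := memLp_two_norm_sq hZ
    rw [Real.norm_of_nonneg (integral_nonneg fun _ => norm_nonneg _),
      ← integral_add_right_eq_self (fun t => ‖F t‖ ^ 2) (h * r), ← integral_add h1 h2]
    refine integral_mono
      (integrable_clm_apply (memLp_comp_add_right hF (h * r)) hZ).norm (h1.add h2) fun t => ?_
    have h3 := (F (t + h * r)).le_opNorm (Z t)
    nlinarith [sq_nonneg (‖F (t + h * r)‖ - ‖Z t‖), sq_nonneg ‖F (t + h * r)‖,
      sq_nonneg ‖Z t‖]
  simp only [intervalIntegral.integral_of_le zero_le_one]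
  exact integral_integral_swap (f := fun t r => F (t + h * r) (Z t))
    (hi.mono_measure (Measure.prod_mono Measure.restrict_le_self le_rfl))

/-- Convergence of the averaged pairings. -/
lemma tendsto_integral_average {F : ℝ → E →L[ℝ] ℝ} {Y : ℝ → E} (hF : MemLp F 2)
    (hY : MemLp Y 2) (hFm : StronglyMeasurable F) (hYm : StronglyMeasurable Y) (s : Set ℝ) :
    Tendsto (fun h => ∫ t in s, ∫ r in (0 : ℝ)..1, F (t + h * r) (Y (t + h) + Y t)) (𝓝 0)
      (𝓝 (2 * ∫ t in s, F t (Y t))) := by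
  have hc := continuous_integral_translate hF hY s
  have h1 : Continuous fun h : ℝ => ∫ r in (0 : ℝ)..1,
      ((∫ t in s, F (t + h * r) (Y (t + h))) + ∫ t in s, F (t + h * r) (Y (t + 0))) := by
    refine intervalIntegral.continuous_parametric_intervalIntegral_of_continuous' ?_ 0 1
    exact (hc.comp (by fun_prop : Continuous fun p : ℝ × ℝ => (p.1 * p.2, p.1))).add
      (hc.comp (by fun_prop : Continuous fun p : ℝ × ℝ => (p.1 * p.2, (0 : ℝ))))
  have h2 := h1.tendsto 0
  simp only [zero_mul, add_zero, intervalIntegral.integral_const, sub_zero, one_smul,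
    ← two_mul] at h2
  refine h2.congr fun h => ?_
  have hYh := memLp_comp_add_right hY h
  refine Eq.trans ?_ (integral_integral_translate_swap hF (hYh.add hY) hFm
    ((hYm.comp_measurable (measurable_add_const h)).add hYm) s h).symm
  refine intervalIntegral.integral_congr fun r _ => ?_
  have hFr := (memLp_comp_add_right hF (h * r)).restrict s
  simp only [Pi.add_apply, map_add]
  exact (integral_add (integrable_clm_apply hFr (hYh.restrict s))
    (integrable_clm_apply hFr (hY.restrict s))).symm

/-- Difference quotients of the primitive of a continuous function, averaged over an interval. -/
lemma tendsto_average_difference {g : ℝ → ℝ} (hg : Continuous g) (a b : ℝ) :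
    Tendsto (fun h => h⁻¹ * ∫ t in a..b, (g (t + h) - g t)) (𝓝[>] 0) (𝓝 (g b - g a)) := by
  have hd : ∀ x, HasDerivAt (fun x => ∫ t in (0 : ℝ)..x, g t) (g x) x := fun x =>
    intervalIntegral.integral_hasDerivAt_right (hg.intervalIntegrable _ _)
      (hg.stronglyMeasurableAtFilter _ _) hg.continuousAt
  refine ((hd b).tendsto_slope_zero_right.sub (hd a).tendsto_slope_zero_right).congr fun h => ?_
  have hi : ∀ a b, IntervalIntegrable g volume a b := fun a b => hg.intervalIntegrable a b
  have hi' : IntervalIntegrable (fun t => g (t + h)) volume a b :=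
    (hg.comp (continuous_add_const h)).intervalIntegrable a b
  rw [intervalIntegral.integral_sub hi' (hi a b), intervalIntegral.integral_comp_add_right,
    ← intervalIntegral.integral_interval_sub_left (hi 0 (b + h)) (hi 0 (a + h)),
    ← intervalIntegral.integral_interval_sub_left (hi 0 b) (hi 0 a)]
  simp only [smul_eq_mul]
  ring

variable {F : Type*} [NormedAddCommGroup F] [InnerProductSpace ℝ F]

/-- A square integrable function on `(0,T)` has a square integrable, strongly measurable
extension to the real line. -/
lemma exists_stronglyMeasurable_memLp {G : Type*} [NormedAddCommGroup G] {T : ℝ} {f : ℝ → G}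
    (hf : MemLp f 2 (timeMeasure T)) :
    ∃ g : ℝ → G, StronglyMeasurable g ∧ MemLp g 2 ∧ ∀ᵐ t, t ∈ Ioo 0 T → g t = f t := by
  have hf' : MemLp ((Ioo 0 T).indicator f) 2 :=
    (memLp_indicator_iff_restrict measurableSet_Ioo).2 hf
  refine ⟨hf'.1.mk _, hf'.1.stronglyMeasurable_mk, hf'.ae_eq hf'.1.ae_eq_mk, ?_⟩
  filter_upwards [hf'.1.ae_eq_mk] with t h1 h2
  rw [← h1, indicator_of_mem h2]

/-- The energy equality for a continuous curve `w` in `F` that agrees with a square integrable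
curve `y` in `E` and has a square integrable derivative `f` in the dual of `E`. -/
theorem norm_sq_sub_norm_sq_eq_integral {T : ℝ} (ι : E →ₗ[ℝ] F) {y : ℝ → E} {f : ℝ → E →L[ℝ] ℝ}
    {w : ℝ → F} (hy : MemLp y 2 (timeMeasure T)) (hf : MemLp f 2 (timeMeasure T))
    (hw : ContinuousOn w (Icc 0 T)) (hwy : ∀ᵐ t ∂(timeMeasure T), w t = ι (y t))
    (hd : ∀ (v : E) (s t : ℝ), 0 < s → s ≤ t → t < T →
      inner ℝ (w t) (ι v) - inner ℝ (w s) (ι v) = ∫ τ in s..t, f τ v)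
    {a b : ℝ} (ha : 0 < a) (hab : a ≤ b) (hb : b < T) :
    ‖w b‖ ^ 2 - ‖w a‖ ^ 2 = 2 * ∫ t in Ioc a b, f t (y t) := by
  have hT : 0 ≤ T := (ha.le.trans hab).trans hb.le
  -- Strongly measurable representatives on the whole line allow translation and give the joint
  -- measurability needed for Fubini.
  obtain ⟨G, hGm, hGL, hGe⟩ := exists_stronglyMeasurable_memLp hf
  obtain ⟨Y, hYm, hYL, hYe⟩ := exists_stronglyMeasurable_memLp hy
  have hwY : ∀ᵐ t, t ∈ Ioo 0 T → w t = ι (Y t) := by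
    filter_upwards [hYe, (ae_restrict_iff' measurableSet_Ioo).1 hwy] with t h1 h2 h3
    rw [h1 h3, h2 h3]
  set g : ℝ → ℝ := IccExtend hT ((Icc 0 T).domRestrict fun t => ‖w t‖ ^ 2) with hg
  have hgc : Continuous g :=
    (continuousOn_iff_continuous_domRestrict.1 (hw.norm.pow 2)).Icc_extend'
  have hge : ∀ t ∈ Icc 0 T, g t = ‖w t‖ ^ 2 := fun t ht => by
    rw [hg, IccExtend_of_mem _ _ ht]; rfl
  have h1 := tendsto_average_difference hgc a b
  have h2 := (tendsto_integral_average hGL hYL hGm hYm (Ioc a b)).mono_left (nhdsWithin_le_nhds (s := Ioi 0))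
  -- The averaged difference quotients of `‖w‖²` and the averaged pairings coincide for small `h >
  -- 0`, so their limits agree.
  have h3 := tendsto_nhds_unique (h1.congr' ?_) h2
  · rw [hge b ⟨ha.le.trans hab, hb.le⟩, hge a ⟨ha.le, hab.trans hb.le⟩] at h3
    rw [h3]
    congr 1
    refine setIntegral_congr_ae measurableSet_Ioc ?_
    filter_upwards [hGe, hYe] with t k1 k2 k3
    have k4 : t ∈ Ioo 0 T := ⟨ha.trans k3.1, k3.2.trans_lt hb⟩
    rw [k1 k4, k2 k4]
  filter_upwards [eventually_mem_nhdsWithin,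
    (eventually_lt_nhds (sub_pos.2 hb)).filter_mono nhdsWithin_le_nhds] with h hh hhb
  have hh0 : 0 < h := hh
  rw [intervalIntegral.integral_of_le hab, ← integral_const_mul]
  refine setIntegral_congr_ae measurableSet_Ioc ?_
  filter_upwards [hwY, (measurePreserving_add_right volume h).quasiMeasurePreserving.ae hwY]
    with t k1 k2 k3
  have k4 : t ∈ Ioo 0 T := ⟨ha.trans k3.1, k3.2.trans_lt hb⟩
  have k5 : t + h ∈ Ioo 0 T := ⟨by linarith [k4.1], by linarith [k3.2]⟩
  -- Polarisation: `‖w(t+h)‖² - ‖w(t)‖²` is the inner product of `w(t+h) - w(t)` with `w(t+h) +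
  -- w(t)`. For fixed `t` and `h` the sum is the image of a single element of `E`, so it may serve
  -- as the fixed test vector.
  have k6 := hd (Y (t + h) + Y t) t (t + h) k4.1 (by linarith) k5.2
  have k7 : ∫ τ in t..t + h, f τ (Y (t + h) + Y t) = ∫ τ in t..t + h, G τ (Y (t + h) + Y t) := by
    refine intervalIntegral.integral_congr_ae ?_
    filter_upwards [hGe] with τ m1 m2
    rw [uIoc_of_le (by linarith)] at m2
    rw [m1 ⟨k4.1.trans m2.1, m2.2.trans_lt k5.2⟩]
  -- The substitution `τ = t + h * r` absorbs the factor `h⁻¹`.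
  have k8 := intervalIntegral.integral_comp_add_mul (a := 0) (b := 1)
    (fun τ => G τ (Y (t + h) + Y t)) hh0.ne' t
  simp only [mul_zero, add_zero, mul_one, smul_eq_mul] at k8
  rw [k8, ← k7, ← k6, map_add, ← k1 k4, ← k2 k5, hge _ (Ioo_subset_Icc_self k4),
    hge _ (Ioo_subset_Icc_self k5), inner_add_right, inner_add_right,
    real_inner_self_eq_norm_sq, real_inner_self_eq_norm_sq, real_inner_comm]
  ring

end Energy

/-! ### Regularity of particle functions. -/

section Particle

lemma memLp_comp_affine {f : ℝ → ℝ} (hc : Continuous f) (hf : MemLp f 2) {c : ℝ} (h : c ≠ 0)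
    (ξ : ℝ) : MemLp (fun x => f (c * (x - ξ))) 2 := by
  have hc' : Continuous fun x => f (c * (x - ξ)) := by fun_prop
  rw [memLp_two_iff_integrable_sq hc'.aestronglyMeasurable]
  exact ((hf.integrable_sq).comp_mul_left' h).comp_sub_right ξ

variable {h : ℝ} (S : ParticleScheme h) (a ξ : Fin S.N → ℝ)

lemma contDiff_particleFun : ContDiff ℝ ∞ (particleFun (dilate S.ζ S.ε) a ξ) := by
  refine ContDiff.sum fun i _ => contDiff_const.mul (contDiff_const.mul (S.ζ_smooth.comp ?_))
  exact contDiff_const.mul (contDiff_id.sub contDiff_const)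

lemma memLp_particleFun : MemLp (particleFun (dilate S.ζ S.ε) a ξ) 2 :=
  memLp_finsetSum _ fun i _ =>
    ((memLp_comp_affine S.ζ_smooth.continuous S.ζ_memLp (inv_ne_zero S.ε_pos.ne')
      (ξ i)).const_mul S.ε⁻¹).const_mul (a i)

lemma deriv_particleFun : deriv (particleFun (dilate S.ζ S.ε) a ξ) =
    fun x => ∑ i, a i * (S.ε⁻¹ * (S.ε⁻¹ * deriv S.ζ (S.ε⁻¹ * (x - ξ i)))) := by
  ext x
  refine HasDerivAt.deriv (HasDerivAt.fun_sum fun i _ => ?_)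
  have h1 : HasDerivAt (fun x => S.ε⁻¹ * (x - ξ i)) S.ε⁻¹ x := by
    simpa using ((hasDerivAt_id x).sub_const (ξ i)).const_mul S.ε⁻¹
  have h2 := (S.ζ_smooth.differentiable (by simp) (S.ε⁻¹ * (x - ξ i))).hasDerivAt
  rw [mul_comm S.ε⁻¹ (deriv _ _)]
  exact ((h2.comp x h1).const_mul S.ε⁻¹).const_mul (a i)

lemma memLp_deriv_particleFun : MemLp (deriv (particleFun (dilate S.ζ S.ε) a ξ)) 2 := by
  rw [deriv_particleFun]
  exact memLp_finsetSum _ fun i _ =>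
    (((memLp_comp_affine (S.ζ_smooth.continuous_deriv (by simp)) S.ζ_memLp_deriv
      (inv_ne_zero S.ε_pos.ne') (ξ i)).const_mul S.ε⁻¹).const_mul S.ε⁻¹).const_mul (a i)

/-- Particle functions are smooth, so the weak derivative is classical and the computation with the
cube applies. -/
lemma integral_convection_particleFun_eq_zero {v : V}
    (hv : (val v : ℝ → ℝ) =ᵐ[volume] particleFun (dilate S.ζ S.ε) a ξ) :
    ∫ x, val v x * weakDeriv v x * val v x = 0 := by
  have hs := contDiff_particleFun S a ξ
  rw [← integral_convection_eq_zero (hs.of_le (by simp)) (memLp_particleFun S a ξ)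
    (memLp_deriv_particleFun S a ξ)]
  refine integral_congr_ae ?_
  filter_upwards [hv, weakDeriv_ae_eq_deriv hs hv] with x h1 h2
  rw [h1, h2]

end Particle

/-! ### Energy equality and growth bound in `W(V)`. -/

/-- The elements of `W(V)`, tested with a fixed element of `V`, are absolutely continuous. -/
lemma W.inner_sub_inner_eq_integral {T : ℝ} (y : W T) (v : V) (s t : ℝ) (hs : 0 < s)
    (hst : s ≤ t) (ht : t < T) :
    inner ℝ (y.traj t) (valₗ v) - inner ℝ (y.traj s) (valₗ v) = ∫ τ in s..t, y.dt τ v := by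
  refine sub_eq_integral_of_weak_deriv (p := fun t => inner ℝ (y.traj t) (valₗ v))
    (y.continuousOn_traj.inner continuousOn_const) ?_ (fun θ hθ => ?_) hs hst ht
  · exact (y.memLp_dt.integrable (by norm_num)).apply_continuousLinearMap v
  · rw [← y.weak_dt v θ hθ]
    refine integral_congr_ae ?_
    filter_upwards [y.traj_eq] with t h1
    simp only [h1]
    rfl

/-- The energy equality in `W(V)`. -/
lemma W.norm_sq_sub_norm_sq {T : ℝ} (y : W T) {a b : ℝ} (ha : 0 < a) (hab : a ≤ b)
    (hb : b < T) :
    ‖y.traj b‖ ^ 2 - ‖y.traj a‖ ^ 2 = 2 * ∫ t in Ioc a b, y.dt t (y.toV t) :=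
  norm_sq_sub_norm_sq_eq_integral valₗ y.memLp_toV y.memLp_dt y.continuousOn_traj y.traj_eq
    y.inner_sub_inner_eq_integral ha hab hb

/-- An element of `W(V)` whose energy is produced at a rate of at most `M ‖y(t)‖` grows at most
linearly in time. -/
lemma W.norm_traj_le {T : ℝ} (hT : 0 < T) (y : W T) {A M : ℝ} (hM : 0 ≤ M)
    (hA : ‖y.traj 0‖ ≤ A)
    (h : ∀ᵐ t ∂(timeMeasure T), y.dt t (y.toV t) ≤ M * ‖y.traj t‖) :
    ‖y.traj T‖ ≤ A + 2 * (M * T) := by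
  -- Bounding the energy production by its value at the maximal norm `K` replaces a Gronwall
  -- argument: it gives `K² ≤ ‖y(0)‖² + 2 M K T`.
  obtain ⟨m, hm, hmax⟩ := isCompact_Icc.exists_isMaxOn (nonempty_Icc.2 hT.le)
    y.continuousOn_traj.norm
  set K := ‖y.traj m‖ with hK
  have hK0 : 0 ≤ K := norm_nonneg _
  have hle : ∀ t ∈ Icc 0 T, ‖y.traj t‖ ≤ K := fun t ht => hmax ht
  have h1 : ∀ a b, 0 < a → a ≤ b → b < T →
      ‖y.traj b‖ ^ 2 ≤ ‖y.traj a‖ ^ 2 + 2 * (M * K * T) := by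
    intro a b ha hab hb
    have hsub : Ioc a b ⊆ Ioo 0 T := fun t ht => ⟨ha.trans ht.1, ht.2.trans_lt hb⟩
    have h2 : ∫ t in Ioc a b, y.dt t (y.toV t) ≤ ∫ t in Ioc a b, M * K := by
      refine integral_mono_ae
        ((integrable_clm_apply y.memLp_dt y.memLp_toV).mono_measure
          (Measure.restrict_mono hsub le_rfl))
        (integrable_const _) ?_
      filter_upwards [ae_restrict_of_ae_restrict_of_subset hsub h,
        ae_restrict_mem measurableSet_Ioc] with t k1 k2
      exact k1.trans (mul_le_mul_of_nonneg_left
        (hle t (Ioo_subset_Icc_self (hsub k2))) hM)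
    have h3 : ∫ t in Ioc a b, M * K = (b - a) * (M * K) := by
      rw [← intervalIntegral.integral_of_le hab, intervalIntegral.integral_const, smul_eq_mul]
    have h4 := y.norm_sq_sub_norm_sq ha hab hb
    have h5 : (b - a) * (M * K) ≤ T * (M * K) :=
      mul_le_mul_of_nonneg_right (by linarith) (mul_nonneg hM hK0)
    linarith
  -- The energy equality is available only strictly inside `(0, T)`; continuity carries the estimate
  -- to both endpoints.
  have hc : ContinuousOn (fun t => ‖y.traj t‖ ^ 2) (Icc 0 T) := y.continuousOn_traj.norm.pow 2
  have hcl : closure (Ioo 0 T) = Icc 0 T := closure_Ioo hT.ne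
  have h2 : ∀ b ∈ Ioo 0 T, ‖y.traj b‖ ^ 2 ≤ ‖y.traj 0‖ ^ 2 + 2 * (M * K * T) := by
    intro b hb
    have hcw : Tendsto (fun t => ‖y.traj t‖ ^ 2) (𝓝[>] 0) (𝓝 (‖y.traj 0‖ ^ 2)) := by
      refine (hc 0 (left_mem_Icc.2 hT.le)).mono_left ?_
      rw [← nhdsWithin_Ioo_eq_nhdsGT hT]
      exact nhdsWithin_mono _ Ioo_subset_Icc_self
    refine ge_of_tendsto (hcw.add_const _) ?_
    filter_upwards [Ioo_mem_nhdsGT hb.1] with a ha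
    exact h1 a b ha.1 ha.2.le hb.2
  have h3 : ∀ b ∈ Icc 0 T, ‖y.traj b‖ ^ 2 ≤ ‖y.traj 0‖ ^ 2 + 2 * (M * K * T) := by
    intro b hb
    rw [← hcl] at hb hc
    exact le_on_closure h2 hc continuousOn_const hb
  have h4 := h3 m hm
  -- If `K > A + 2 M T`, then `K² > A K + 2 M T K ≥ ‖y(0)‖² + 2 M K T`, a contradiction.
  refine (hle T (right_mem_Icc.2 hT.le)).trans (le_of_not_gt fun h5 => ?_)
  have h6 : 0 ≤ ‖y.traj 0‖ := norm_nonneg _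
  have h7 : 0 ≤ M * T := mul_nonneg hM hT.le
  nlinarith

/-! ### Uniform bounds for discrete states and optimal controls. -/

namespace ControlProblem

variable (P : ControlProblem)

/-- The localisation function as an element of `H`. -/
def χH : H := (P.χ_smooth.continuous.memLp_of_hasCompactSupport P.χ_supp : MemLp P.χ 2 volume).toLp

lemma integral_χ_mul (f : H) : ∫ x, P.χ x * f x = inner ℝ P.χH f := by
  rw [L2.inner_def]
  refine integral_congr_ae ?_
  filter_upwards [(P.χ_smooth.continuous.memLp_of_hasCompactSupport P.χ_supp :
    MemLp P.χ 2 volume).coeFn_toLp] with x hx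
  simp [χH, hx, mul_comm]

variable {P} {h : ℝ} {S : ParticleScheme h} {y : W P.T} {Φ : Fin S.N → ℝ → ℝ} {u : H1Time P.T}

/-- The initial value of a discrete state is bounded by that of the continuous problem. -/
lemma IsDiscreteState.norm_traj_zero_le (hy : P.IsDiscreteState S y Φ u) :
    ‖y.traj 0‖ ≤ ‖val P.y0‖ := by
  obtain ⟨-, ⟨α, hα, hΦ⟩, -, h0⟩ := hy
  have h00 : (0 : ℝ) ∈ Icc 0 P.T := left_mem_Icc.2 P.T_pos.le
  have hX : (fun i => Φ i 0) = S.X := funext fun i => by simpa using (hΦ i).2 0 h00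
  have hα0 := hα 0 h00
  rw [hX] at hα0
  obtain ⟨v, hv⟩ := exists_V_of_contDiff (contDiff_particleFun S (fun i => α i 0) S.X)
    (memLp_particleFun S _ _) (memLp_deriv_particleFun S _ _)
  have hvy : val v = y.traj 0 := Lp.ext (hv.trans hα0.symm)
  -- At time `0` the particles sit at `S.X`, so the initial value is itself an admissible test
  -- function: `‖y(0)‖² = ⟨y₀, y(0)⟩`.
  have h1 := h0 v (S.particle_mem_test _ _ v hv)
  rw [hvy, real_inner_self_eq_norm_sq] at h1
  have h2 := real_inner_le_norm (val P.y0) (y.traj 0)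
  by_contra! hc
  nlinarith [norm_nonneg (val P.y0), norm_nonneg (y.traj 0)]

/-- The energy of a discrete state is only increased by the control. -/
lemma IsDiscreteState.dt_apply_le (hy : P.IsDiscreteState S y Φ u) {c : ℝ}
    (hu : ∀ᵐ t ∂(timeMeasure P.T), |val u t| ≤ c) :
    ∀ᵐ t ∂(timeMeasure P.T), y.dt t (y.toV t) ≤ c * ‖P.χH‖ * ‖y.traj t‖ := by
  obtain ⟨-, ⟨α, hα, -⟩, hB, -⟩ := hy
  filter_upwards [hB, hu, y.traj_eq, ae_restrict_mem measurableSet_Ioo] with t h1 h2 h3 h4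
  have hα' := hα t (Ioo_subset_Icc_self h4)
  rw [h3] at hα'
  -- The equation is tested with the state itself, a particle function at the current positions.
  have h5 := h1 (y.toV t) (S.particle_mem_test _ _ _ hα')
  rw [BurgersAt, integral_convection_particleFun_eq_zero S _ _ hα', P.integral_χ_mul,
    real_inner_self_eq_norm_sq] at h5
  have h6 : val u t * inner ℝ P.χH (val (y.toV t)) ≤ c * (‖P.χH‖ * ‖val (y.toV t)‖) := by
    refine (le_abs_self _).trans ?_
    rw [abs_mul]
    exact mul_le_mul h2 (abs_real_inner_le_norm _ _) (abs_nonneg _) ((abs_nonneg _).trans h2)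
  have h7 := mul_nonneg P.ν_pos.le (sq_nonneg ‖weakDeriv (y.toV t)‖)
  rw [h3]
  linarith

/-- A bound for the final value of a discrete state that is uniform in the discretisation. -/
lemma IsDiscreteState.norm_traj_final_le (hy : P.IsDiscreteState S y Φ u) {c : ℝ} (hc : 0 ≤ c)
    (hu : ∀ᵐ t ∂(timeMeasure P.T), |val u t| ≤ c) :
    ‖y.traj P.T‖ ≤ ‖val P.y0‖ + 2 * (c * ‖P.χH‖ * P.T) :=
  y.norm_traj_le P.T_pos (mul_nonneg hc (norm_nonneg _)) hy.norm_traj_zero_le (hy.dt_apply_le hu)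

variable (P) in
/-- The controls are bounded by the cost. -/
lemma norm_le_of_J_le (y : W P.T) (u : H1Time P.T) {B : ℝ} (hB : P.J y u ≤ B) :
    ‖u‖ ≤ 1 + 2 * |B| / P.σ := by
  have h1 : P.σ / 2 * ‖u‖ ^ 2 ≤ |B| := by
    have h2 : P.σ / 2 * ‖u‖ ^ 2 ≤ P.J y u := le_add_of_nonneg_left (by positivity)
    exact h2.trans (hB.trans (le_abs_self B))
  have h3 : ‖u‖ ^ 2 ≤ 2 * |B| / P.σ := by
    rw [le_div_iff₀ P.σ_pos]
    linarith
  nlinarith [sq_nonneg (‖u‖ - 1)]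

variable (P) in
/-- The optimal controls of the continuous problem are bounded. -/
lemma exists_bound_isSolution :
    ∃ C : ℝ, 0 < C ∧ ∀ (y : W P.T) (u : H1Time P.T), P.IsSolution y u → ‖u‖ ≤ C := by
  -- Existence of a minimiser is not needed: without one the bound is vacuous.
  by_cases hex : ∃ (y : W P.T) (u : H1Time P.T), P.IsSolution y u
  · obtain ⟨y₀, u₀, h₀⟩ := hex
    have hσ := P.σ_pos
    exact ⟨1 + 2 * |P.J y₀ u₀| / P.σ, by positivity, fun y u hyu =>
      P.norm_le_of_J_le y u (hyu.2.2 y₀ u₀ h₀.1 h₀.2.1)⟩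
  · exact ⟨1, one_pos, fun y u hyu => (hex ⟨y, u, hyu⟩).elim⟩

variable (P) in
/-- The optimal controls of the discrete problems are bounded uniformly in the discretisation. -/
lemma exists_bound_isDiscreteSolution :
    ∃ C : ℝ, 0 < C ∧ ∀ (h : ℝ) (S : ParticleScheme h), P.DiscreteSolvable S →
      ∀ (y : W P.T) (Φ : Fin S.N → ℝ → ℝ) (u : H1Time P.T),
        P.IsDiscreteSolution S y Φ u → ‖u‖ ≤ C := by
  obtain ⟨u₀, hu₀⟩ := exists_H1Time_const P.T P.ul
  have hσ := P.σ_pos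
  have had : u₀ ∈ P.Uad := by
    filter_upwards [hu₀] with t ht
    rw [ht]
    exact ⟨le_rfl, P.ul_le_uu⟩
  -- `R` bounds the final misfit of every discrete state of the constant control, and `B` its cost;
  -- both depend only on the data of `P` and on `u₀`.
  set R := ‖val P.y0‖ + 2 * (|P.ul| * ‖P.χH‖ * P.T) + ‖P.yd‖ with hR
  set B := 1 / 2 * R ^ 2 + P.σ / 2 * ‖u₀‖ ^ 2
  refine ⟨1 + 2 * |B| / P.σ, by positivity, fun h S hS y Φ u hyu => ?_⟩
  -- Discrete solvability enters only here, for the constant control.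
  obtain ⟨y', Φ', hy'⟩ := hS u₀ had
  refine P.norm_le_of_J_le y u ((hyu.2.2 y' Φ' u₀ had hy').trans ?_)
  have h1 : ‖y'.traj P.T - P.yd‖ ≤ R := (norm_sub_le _ _).trans <| add_le_add_left
    (hy'.norm_traj_final_le (abs_nonneg _) (hu₀.mono fun t ht => by rw [ht])) _
  have h2 : ‖y'.traj P.T - P.yd‖ ^ 2 ≤ R ^ 2 := pow_le_pow_left₀ (norm_nonneg _) h1 2
  exact add_le_add_left (mul_le_mul_of_nonneg_left h2 (by norm_num)) _

end ControlProblem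

end BurgersControl

end

theorem mainTheorem12 (P : BurgersControl.ControlProblem) :
    ∃ C : ℝ, 0 < C ∧
      (∀ (y : BurgersControl.W P.T) (u : BurgersControl.H1Time P.T),
        P.IsSolution y u → ‖u‖ ≤ C) ∧
      ∀ (h : ℝ), 0 < h → ∀ S : BurgersControl.ParticleScheme h, P.DiscreteSolvable S →
        ∀ (y : BurgersControl.W P.T) (Φ : Fin S.N → ℝ → ℝ) (u : BurgersControl.H1Time P.T),
          P.IsDiscreteSolution S y Φ u → ‖u‖ ≤ C := by 
  obtain ⟨C₁, hC₁, h₁⟩ := P.exists_bound_isSolution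
  obtain ⟨C₂, -, h₂⟩ := P.exists_bound_isDiscreteSolution
  exact ⟨max C₁ C₂, lt_max_of_lt_left hC₁, fun y u hyu => (h₁ y u hyu).trans (le_max_left _ _),
    fun h _ S hS y Φ u hyu => (h₂ h S hS y Φ u hyu).trans (le_max_right _ _)⟩
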